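/- Let $\ell$ be a commutative unital ring with involution. All $*$-algebras are over $\ell$, with semilinear involution, and $*$-homomorphisms need not be unital. A projection in a $*$-algebra $A$ is a self-adjoint idempotent. Two projections $p,q$ are equivalent, $p\sim q$, if $p=x^*x$ and $q=xx^*$ for some $x\in A$. Let $\mathcal V_\infty(A)^*$ be the abelian monoid, under orthogonal sum, of equivalence classes of projections in $M_\infty(A)=\bigcup_n M_n(A)$ (conjugate transpose involution), and let $K_0(A)^*$ be its group completion, where $A$ is either unital or a Leavitt path algebra. Let $E=(s,r:E^1\rightrightarrows E^0)$ be a directed graph. A vertex $v$ is singular if $s^{-1}(v)$ is empty or infinite, and regular otherwise. Let $A_E$ be the $\operatorname{reg}(E)\times E^0$-matrix with $(A_E)_{v,w}=|s^{-1}(v)\cap r^{-1}(w)|$, and let $$\mathfrak{BF}(E)=\operatorname{Coker}\big(I-A_E^t:\mathbb Z^{(\operatorname{reg}(E))}\to\mathbb Z^{(E^0)}\big).$$ Let $L(E)$ be the Leavitt path algebra of $E$ over $\ell$ with its standard involution, which fixes the vertices and maps each edge $e$ to the phantom edge $e^*$, and let $\operatorname{can}':\mathfrak{BF}(E)\to K_0(L(E))^*$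 be the group homomorphism with $\operatorname{can}'([v])=[v]$ for $v\in E^0$. Let $R$ be a unital $*$-algebra which is strictly properly infinite, that is, there are $s_1,s_2\in R$ with $s_i^*s_j=\delta_{i,j}$. A projection $p\in R$ is very full if there is a projection $q\in R$ with $q=pq=qp$ and $q\sim 1$. A $*$-homomorphism $\phi:L(E)\to R$ is very full if $\phi(ee^*)$ is a very full projection for every $e\in E^1$ and $\phi(v)$ is a very full projection for every singular vertex $v$. Theorem. Let $E$ be a countable graph ($E^0$ and $E^1$ countable), $R$ a unital strictly properly infinite $*$-algebra, and $\xi:\mathfrak{BF}(E)\to K_0(R)^*$ a group homomorphism. Then there is a very full $*$-homomorphism $\phi:L(E)\to R$ such that $K_0(\phi)^*\circ\operatorname{can}'=\xi$. If furthermore $E^0$ is finite and nonempty and $p\in R$ is a very full projection such that $\xi\big(\sum_{v\in E^0}[v]\big)=[p]$, then $\phi$ can be chosen so that in addition $\phi(1)=p$. -/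

import Mathlib

open scoped Matrix

noncomputable section

universe u v w x

/-! ### Directed graphs -/

/-- A directed graph with vertex set `V` and edge set `E` (loops and multiple edges allowed),
given by its source and range maps. -/
structure DirGraph (V : Type u) (E : Type v) where
  s : E → V
  r : E → V

namespace DirGraph

variable {V : Type u} {E : Type v} (G : DirGraph V E)

/-- The set of edges emitted by a vertex. -/
def emitted (a : V) : Set E := {e | G.s e = a}

def IsSink (a : V) : Prop := G.emitted a = ∅

def IsInfiniteEmitter (a : V) : Prop := (G.emitted a).Infinite

/-- A vertex is singular if it is a sink or an infinite emitter. -/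
def IsSingular (a : V) : Prop := G.IsSink a ∨ G.IsInfiniteEmitter a

/-- A vertex is regular if it is not singular. -/
def IsRegular (a : V) : Prop := ¬ G.IsSingular a

theorem IsRegular.finite {G : DirGraph V E} {a : V} (h : G.IsRegular a) :
    (G.emitted a).Finite :=
  Set.not_infinite.1 fun h' => h (Or.inr h')

theorem IsRegular.nonempty {G : DirGraph V E} {a : V} (h : G.IsRegular a) :
    (G.emitted a).Nonempty :=
  Set.nonempty_iff_ne_empty.2 fun h' => h (Or.inl h')

/-- The number of edges from `a` to `b`, for `a` regular: the entry `(a, b)` of the reduced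
incidence matrix, whose rows are indexed by the regular vertices. -/
def incidence (a : {a : V // G.IsRegular a}) (b : V) : ℕ :=
  {e : E | G.s e = a ∧ G.r e = b}.ncard

theorem incidence_support (a : {a : V // G.IsRegular a}) :
    (Function.support fun b => (G.incidence a b : ℤ)).Finite := by
  refine (a.2.finite.image G.r).subset fun b hb => ?_
  have h : {e : E | G.s e = a ∧ G.r e = b}.ncard ≠ 0 := by
    simpa [incidence] using hb
  obtain ⟨e, he⟩ := Set.nonempty_of_ncard_ne_zero h
  exact ⟨e, he.1, he.2⟩

/-- The matrix `I - Aᵗ`, with rows indexed by all vertices and columns indexed by the regular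
ones, as a homomorphism `ℤ^(reg) → ℤ^(V)`. -/
def oneSubIncidenceTranspose : ({a : V // G.IsRegular a} →₀ ℤ) →ₗ[ℤ] (V →₀ ℤ) :=
  Finsupp.linearCombination ℤ fun a : {a : V // G.IsRegular a} =>
    Finsupp.single (a : V) (1 : ℤ) -
      Finsupp.ofSupportFinite (fun b => (G.incidence a b : ℤ)) (G.incidence_support a)

/-- The Bowen-Franks group, the cokernel of `I - Aᵗ`. -/
abbrev BowenFranks : Type u :=
  (V →₀ ℤ) ⧸ LinearMap.range G.oneSubIncidenceTranspose

/-- The class of a vertex in the Bowen-Franks group. -/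
def bfClass (a : V) : G.BowenFranks :=
  Submodule.Quotient.mk (Finsupp.single a 1)

/-- The sum of the classes of all vertices. -/
def bfOne [Fintype V] : G.BowenFranks := ∑ a, G.bfClass a

theorem incidence_column (a : {a : V // G.IsRegular a}) :
    Finsupp.ofSupportFinite (fun b => (G.incidence a b : ℤ)) (G.incidence_support a) =
      ∑ e ∈ a.2.finite.toFinset, Finsupp.single (G.r e) (1 : ℤ) := by
  classical
  ext b
  rw [Finsupp.ofSupportFinite_coe, Finsupp.finsetSum_apply]
  simp only [Finsupp.single_apply, Finset.sum_boole]
  congr 1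
  rw [incidence, ← Set.ncard_coe_finset]
  congr 1
  ext e
  simp [emitted]

end DirGraph

/-! ### The Leavitt path algebra -/

/-- Formal expressions in the vertices, the edges and the phantom edges of a graph. -/
inductive LeavittPre (ℓ : Type w) (V : Type u) (E : Type v) : Type (max u v w)
  | vertex (a : V)
  | edge (e : E)
  | ghost (e : E)
  | zero
  | add (f g : LeavittPre ℓ V E)
  | neg (f : LeavittPre ℓ V E)
  | mul (f g : LeavittPre ℓ V E)
  | smul (c : ℓ) (f : LeavittPre ℓ V E)

namespace LeavittPre

variable {ℓ : Type w} {V : Type u} {E : Type v}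

/-- The formal sum of `e e*` over a list of edges. -/
def sumRangeProj (l : List E) : LeavittPre ℓ V E :=
  l.foldr (fun e f => add (mul (edge e) (ghost e)) f) zero

/-- The relations defining the Leavitt path algebra as a (not necessarily unital) associative
`ℓ`-algebra: first compatibility with the operations, then the axioms of an algebra, then the
relations attached to the graph. -/
inductive Rel [CommRing ℓ] (G : DirGraph V E) : LeavittPre ℓ V E → LeavittPre ℓ V E → Prop
  | symm {f g} : Rel G f g → Rel G g f
  | add_left {f f'} (g) : Rel G f f' → Rel G (add f g) (add f' g)
  | add_right (f) {g g'} : Rel G g g' → Rel G (add f g) (add f g')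
  | neg {f f'} : Rel G f f' → Rel G (neg f) (neg f')
  | mul_left {f f'} (g) : Rel G f f' → Rel G (mul f g) (mul f' g)
  | mul_right (f) {g g'} : Rel G g g' → Rel G (mul f g) (mul f g')
  | smul (c) {f f'} : Rel G f f' → Rel G (smul c f) (smul c f')
  | add_assoc (f g h) : Rel G (add (add f g) h) (add f (add g h))
  | add_comm (f g) : Rel G (add f g) (add g f)
  | zero_add (f) : Rel G (add zero f) f
  | neg_add (f) : Rel G (add (LeavittPre.neg f) f) zero
  | mul_assoc (f g h) : Rel G (mul (mul f g) h) (mul f (mul g h))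
  | mul_add (f g h) : Rel G (mul f (add g h)) (add (mul f g) (mul f h))
  | add_mul (f g h) : Rel G (mul (add f g) h) (add (mul f h) (mul g h))
  | smul_add (c f g) : Rel G (LeavittPre.smul c (add f g))
      (add (LeavittPre.smul c f) (LeavittPre.smul c g))
  | add_smul (c d f) : Rel G (LeavittPre.smul (c + d) f)
      (add (LeavittPre.smul c f) (LeavittPre.smul d f))
  | mul_smul (c d f) : Rel G (LeavittPre.smul (c * d) f)
      (LeavittPre.smul c (LeavittPre.smul d f))
  | one_smul (f) : Rel G (LeavittPre.smul 1 f) f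
  | smul_mul (c f g) : Rel G (mul (LeavittPre.smul c f) g) (LeavittPre.smul c (mul f g))
  | mul_smul_comm (c f g) : Rel G (mul f (LeavittPre.smul c g)) (LeavittPre.smul c (mul f g))
  | vertex_mul_self (a) : Rel G (mul (vertex a) (vertex a)) (vertex a)
  | vertex_mul_ne (a b) : a ≠ b → Rel G (mul (vertex a) (vertex b)) zero
  | source_mul_edge (e) : Rel G (mul (vertex (G.s e)) (edge e)) (edge e)
  | edge_mul_range (e) : Rel G (mul (edge e) (vertex (G.r e))) (edge e)
  | range_mul_ghost (e) : Rel G (mul (vertex (G.r e)) (ghost e)) (ghost e)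
  | ghost_mul_source (e) : Rel G (mul (ghost e) (vertex (G.s e))) (ghost e)
  | ghost_mul_self (e) : Rel G (mul (ghost e) (edge e)) (vertex (G.r e))
  | ghost_mul_ne (e f) : e ≠ f → Rel G (mul (ghost e) (edge f)) zero
  | vertex_eq_sum (a) (l : List E) : G.IsRegular a → l.Nodup → (∀ e, e ∈ l ↔ G.s e = a) →
      Rel G (vertex a) (sumRangeProj l)

/-- The standard semilinear involution on formal expressions. -/
def adj [Star ℓ] : LeavittPre ℓ V E → LeavittPre ℓ V E
  | vertex a => vertex a
  | edge e => ghost e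
  | ghost e => edge e
  | zero => zero
  | add f g => add (adj f) (adj g)
  | neg f => neg (adj f)
  | mul f g => mul (adj g) (adj f)
  | smul c f => smul (star c) (adj f)

theorem adj_sumRangeProj [Star ℓ] (l : List E) :
    adj (sumRangeProj l : LeavittPre ℓ V E) = sumRangeProj l := by
  induction l with
  | nil => rfl
  | cons e l ih => simp only [sumRangeProj, List.foldr_cons, adj] at ih ⊢; rw [ih]

theorem adj_adj [InvolutiveStar ℓ] (f : LeavittPre ℓ V E) : adj (adj f) = f := by
  induction f <;> simp_all [adj]

theorem Rel.adj [CommRing ℓ] [StarRing ℓ] {G : DirGraph V E} {f g : LeavittPre ℓ V E}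
    (h : Rel G f g) : Rel G f.adj g.adj := by
  induction h with
  | symm _ ih => exact .symm ih
  | add_left g _ ih => exact .add_left _ ih
  | add_right f _ ih => exact .add_right _ ih
  | neg _ ih => exact .neg ih
  | mul_left g _ ih => exact .mul_right _ ih
  | mul_right f _ ih => exact .mul_left _ ih
  | smul c _ ih => exact .smul _ ih
  | add_assoc f g h => exact .add_assoc _ _ _
  | add_comm f g => exact .add_comm _ _
  | zero_add f => exact .zero_add _
  | neg_add f => exact .neg_add _
  | mul_assoc f g h => exact .symm (.mul_assoc _ _ _)
  | mul_add f g h => exact .add_mul _ _ _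
  | add_mul f g h => exact .mul_add _ _ _
  | smul_add c f g => exact .smul_add _ _ _
  | add_smul c d f => simp only [LeavittPre.adj, star_add]; exact .add_smul _ _ _
  | mul_smul c d f => simp only [LeavittPre.adj, star_mul']; exact .mul_smul _ _ _
  | one_smul f => simp only [LeavittPre.adj, star_one]; exact .one_smul _
  | smul_mul c f g => exact .mul_smul_comm _ _ _
  | mul_smul_comm c f g => exact .smul_mul _ _ _
  | vertex_mul_self a => exact .vertex_mul_self _
  | vertex_mul_ne a b hab => exact .vertex_mul_ne _ _ hab.symm
  | source_mul_edge e => exact .ghost_mul_source _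
  | edge_mul_range e => exact .range_mul_ghost _
  | range_mul_ghost e => exact .edge_mul_range _
  | ghost_mul_source e => exact .source_mul_edge _
  | ghost_mul_self e => exact .ghost_mul_self _
  | ghost_mul_ne e f hef => exact .ghost_mul_ne _ _ hef.symm
  | vertex_eq_sum a l ha hl hl' =>
    rw [adj_sumRangeProj]
    exact .vertex_eq_sum _ _ ha hl hl'

end LeavittPre

/-- The Leavitt path algebra `L(G)` over `ℓ`, not unital in general. -/
def Leavitt (ℓ : Type w) [CommRing ℓ] {V : Type u} {E : Type v} (G : DirGraph V E) :
    Type (max u v w) :=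
  Quot (LeavittPre.Rel (ℓ := ℓ) G)

namespace Leavitt

open LeavittPre (Rel)

variable {ℓ : Type w} [CommRing ℓ] {V : Type u} {E : Type v} {G : DirGraph V E}

instance : Zero (Leavitt ℓ G) := ⟨Quot.mk _ .zero⟩

instance : Add (Leavitt ℓ G) :=
  ⟨Quot.map₂ .add (fun f _ _ h => .add_right f h) (fun _ _ g h => .add_left g h)⟩

instance : Neg (Leavitt ℓ G) := ⟨Quot.map .neg fun _ _ h => .neg h⟩

instance : Mul (Leavitt ℓ G) :=
  ⟨Quot.map₂ .mul (fun f _ _ h => .mul_right f h) (fun _ _ g h => .mul_left g h)⟩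

instance : SMul ℓ (Leavitt ℓ G) := ⟨fun c => Quot.map (.smul c) fun _ _ h => .smul c h⟩

instance : AddCommGroup (Leavitt ℓ G) where
  add_assoc := by rintro ⟨f⟩ ⟨g⟩ ⟨h⟩; exact Quot.sound (.add_assoc f g h)
  zero_add := by rintro ⟨f⟩; exact Quot.sound (.zero_add f)
  add_zero := by
    rintro ⟨f⟩
    exact (Quot.sound (.add_comm f .zero)).trans (Quot.sound (.zero_add f))
  add_comm := by rintro ⟨f⟩ ⟨g⟩; exact Quot.sound (.add_comm f g)
  neg_add_cancel := by rintro ⟨f⟩; exact Quot.sound (.neg_add f)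
  nsmul := nsmulRec
  zsmul := zsmulRec

theorem mul_add' (f g h : Leavitt ℓ G) : f * (g + h) = f * g + f * h := by
  obtain ⟨f⟩ := f
  obtain ⟨g⟩ := g
  obtain ⟨h⟩ := h
  exact Quot.sound (.mul_add f g h)

theorem add_mul' (f g h : Leavitt ℓ G) : (f + g) * h = f * h + g * h := by
  obtain ⟨f⟩ := f
  obtain ⟨g⟩ := g
  obtain ⟨h⟩ := h
  exact Quot.sound (.add_mul f g h)

instance : NonUnitalRing (Leavitt ℓ G) where
  left_distrib := mul_add'
  right_distrib := add_mul'
  zero_mul f := by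
    have h := add_mul' 0 0 f
    rwa [add_zero, left_eq_add] at h
  mul_zero f := by
    have h := mul_add' f 0 0
    rwa [add_zero, left_eq_add] at h
  mul_assoc := by rintro ⟨f⟩ ⟨g⟩ ⟨h⟩; exact Quot.sound (.mul_assoc f g h)

instance : Module ℓ (Leavitt ℓ G) :=
  Module.ofMinimalAxioms
    (by rintro c ⟨f⟩ ⟨g⟩; exact Quot.sound (.smul_add c f g))
    (by rintro c d ⟨f⟩; exact Quot.sound (.add_smul c d f))
    (by rintro c d ⟨f⟩; exact Quot.sound (.mul_smul c d f))
    (by rintro ⟨f⟩; exact Quot.sound (.one_smul f))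

instance : IsScalarTower ℓ (Leavitt ℓ G) (Leavitt ℓ G) :=
  ⟨by rintro c ⟨f⟩ ⟨g⟩; exact Quot.sound (.smul_mul c f g)⟩

instance : SMulCommClass ℓ (Leavitt ℓ G) (Leavitt ℓ G) :=
  ⟨by rintro c ⟨f⟩ ⟨g⟩; exact (Quot.sound (.mul_smul_comm c f g)).symm⟩

/-- The standard involution: it is `ℓ`-semilinear, fixes the vertices and exchanges each edge
with its phantom edge. -/
instance [StarRing ℓ] : StarRing (Leavitt ℓ G) where
  star := Quot.map .adj fun _ _ h => h.adj
  star_involutive := by rintro ⟨f⟩; exact congrArg (Quot.mk _) f.adj_adj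
  star_mul := by rintro ⟨f⟩ ⟨g⟩; rfl
  star_add := by rintro ⟨f⟩ ⟨g⟩; rfl

instance [StarRing ℓ] : StarModule ℓ (Leavitt ℓ G) := ⟨by rintro c ⟨f⟩; rfl⟩

variable (ℓ G)

def vertex (a : V) : Leavitt ℓ G := Quot.mk _ (.vertex a)

def edge (e : E) : Leavitt ℓ G := Quot.mk _ (.edge e)

/-- The phantom edge `e*`. -/
def ghost (e : E) : Leavitt ℓ G := Quot.mk _ (.ghost e)

/-- The sum of all vertices, which is the unit of `L(G)` when there are finitely many of them. -/
def unit [Fintype V] : Leavitt ℓ G := ∑ a, vertex ℓ G a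

theorem star_vertex [StarRing ℓ] (a : V) : star (vertex ℓ G a) = vertex ℓ G a := rfl

theorem star_edge [StarRing ℓ] (e : E) : star (edge ℓ G e) = ghost ℓ G e := rfl

theorem star_ghost [StarRing ℓ] (e : E) : star (ghost ℓ G e) = edge ℓ G e := rfl

theorem vertex_mul_self (a : V) : vertex ℓ G a * vertex ℓ G a = vertex ℓ G a :=
  Quot.sound (.vertex_mul_self a)

theorem vertex_mul_ne {a b : V} (h : a ≠ b) : vertex ℓ G a * vertex ℓ G b = 0 :=
  Quot.sound (.vertex_mul_ne a b h)

theorem source_mul_edge (e : E) : vertex ℓ G (G.s e) * edge ℓ G e = edge ℓ G e :=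
  Quot.sound (.source_mul_edge e)

theorem edge_mul_range (e : E) : edge ℓ G e * vertex ℓ G (G.r e) = edge ℓ G e :=
  Quot.sound (.edge_mul_range e)

theorem range_mul_ghost (e : E) : vertex ℓ G (G.r e) * ghost ℓ G e = ghost ℓ G e :=
  Quot.sound (.range_mul_ghost e)

theorem ghost_mul_source (e : E) : ghost ℓ G e * vertex ℓ G (G.s e) = ghost ℓ G e :=
  Quot.sound (.ghost_mul_source e)

theorem ghost_mul_self (e : E) : ghost ℓ G e * edge ℓ G e = vertex ℓ G (G.r e) :=
  Quot.sound (.ghost_mul_self e)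

theorem ghost_mul_ne {e f : E} (h : e ≠ f) : ghost ℓ G e * edge ℓ G f = 0 :=
  Quot.sound (.ghost_mul_ne e f h)

theorem mk_sumRangeProj (l : List E) :
    (Quot.mk _ (LeavittPre.sumRangeProj l) : Leavitt ℓ G) =
      (l.map fun e => edge ℓ G e * ghost ℓ G e).sum := by
  induction l with
  | nil => rfl
  | cons e l ih => rw [List.map_cons, List.sum_cons, ← ih]; rfl

theorem vertex_eq_sum {a : V} (ha : G.IsRegular a) :
    vertex ℓ G a = ∑ e ∈ ha.finite.toFinset, edge ℓ G e * ghost ℓ G e := by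
  have h : vertex ℓ G a = Quot.mk _ (LeavittPre.sumRangeProj ha.finite.toFinset.toList) :=
    Quot.sound (.vertex_eq_sum a _ ha (Finset.nodup_toList _)
      (fun e => by simp [DirGraph.emitted]))
  rw [h, mk_sumRangeProj, Finset.sum_map_toList]

theorem isStarProjection_vertex [StarRing ℓ] (a : V) : IsStarProjection (vertex ℓ G a) :=
  ⟨vertex_mul_self ℓ G a, star_vertex ℓ G a⟩

theorem unit_mul [Fintype V] (f : Leavitt ℓ G) : unit ℓ G * f = f := by
  classical
  have hv (a : V) : unit ℓ G * vertex ℓ G a = vertex ℓ G a := by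
    rw [unit, Finset.sum_mul, Finset.sum_eq_single a
      (fun b _ hb => vertex_mul_ne ℓ G hb) (by simp), vertex_mul_self]
  obtain ⟨f⟩ := f
  induction f with
  | vertex a => exact hv a
  | edge e =>
    change unit ℓ G * edge ℓ G e = edge ℓ G e
    rw [← source_mul_edge, ← mul_assoc, hv]
  | ghost e =>
    change unit ℓ G * ghost ℓ G e = ghost ℓ G e
    rw [← range_mul_ghost, ← mul_assoc, hv]
  | zero => exact mul_zero _
  | add f g hf hg => exact (mul_add _ _ _).trans (congrArg₂ _ hf hg)
  | neg f hf => exact (mul_neg _ _).trans (congrArg _ hf)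
  | mul f g hf hg =>
    let f' : Leavitt ℓ G := Quot.mk _ f
    let g' : Leavitt ℓ G := Quot.mk _ g
    change unit ℓ G * (f' * g') = f' * g'
    rw [← mul_assoc, show unit ℓ G * f' = f' from hf]
  | smul c f hf => exact (mul_smul_comm c _ _).trans (congrArg _ hf)

theorem mul_unit [Fintype V] (f : Leavitt ℓ G) : f * unit ℓ G = f := by
  classical
  have hv (a : V) : vertex ℓ G a * unit ℓ G = vertex ℓ G a := by
    rw [unit, Finset.mul_sum, Finset.sum_eq_single a
      (fun b _ hb => vertex_mul_ne ℓ G hb.symm) (by simp), vertex_mul_self]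
  obtain ⟨f⟩ := f
  induction f with
  | vertex a => exact hv a
  | edge e =>
    change edge ℓ G e * unit ℓ G = edge ℓ G e
    rw [← edge_mul_range, mul_assoc, hv]
  | ghost e =>
    change ghost ℓ G e * unit ℓ G = ghost ℓ G e
    rw [← ghost_mul_source, mul_assoc, hv]
  | zero => exact zero_mul _
  | add f g hf hg => exact (add_mul _ _ _).trans (congrArg₂ _ hf hg)
  | neg f hf => exact (neg_mul _ _).trans (congrArg _ hf)
  | mul f g hf hg =>
    let f' : Leavitt ℓ G := Quot.mk _ f
    let g' : Leavitt ℓ G := Quot.mk _ g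
    change f' * g' * unit ℓ G = f' * g'
    rw [mul_assoc, show g' * unit ℓ G = g' from hg]
  | smul c f hf => exact (smul_mul_assoc c _ _).trans (congrArg _ hf)

end Leavitt

/-! ### Projections, Murray-von Neumann equivalence and `K₀` -/

section Matrices

variable {A : Type x} [NonUnitalRing A] [StarRing A]

/-- Murray-von Neumann equivalence of square matrices of possibly different sizes. For projections
`p` and `q` this is the same as equivalence in a common larger matrix algebra after padding with
zeros, since the partial isometry `x` may be replaced by `q x p`. -/
def MatEquiv {ι κ : Type} [Fintype ι] [Fintype κ] (p : Matrix ι ι A) (q : Matrix κ κ A) : Prop :=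
  ∃ x : Matrix κ ι A, xᴴ * x = p ∧ x * xᴴ = q

variable {ι κ μ ν : Type} [Fintype ι] [Fintype κ] [Fintype μ] [Fintype ν]

theorem MatEquiv.refl {p : Matrix ι ι A} (hp : IsStarProjection p) : MatEquiv p p := by
  have h1 : pᴴ = p := hp.isSelfAdjoint
  have h2 : p * p = p := hp.isIdempotentElem
  exact ⟨p, by rw [h1, h2], by rw [h1, h2]⟩

theorem MatEquiv.symm {p : Matrix ι ι A} {q : Matrix κ κ A} (h : MatEquiv p q) :
    MatEquiv q p := by
  obtain ⟨x, h1, h2⟩ := h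
  exact ⟨xᴴ, by rw [Matrix.conjTranspose_conjTranspose, h2],
    by rw [Matrix.conjTranspose_conjTranspose, h1]⟩

theorem MatEquiv.trans {p : Matrix ι ι A} {q : Matrix κ κ A} {t : Matrix μ μ A}
    (hp : IsStarProjection p) (ht : IsStarProjection t)
    (h : MatEquiv p q) (h' : MatEquiv q t) : MatEquiv p t := by
  obtain ⟨x, h1, h2⟩ := h
  obtain ⟨y, h3, h4⟩ := h'
  have hp' : p * p = p := hp.isIdempotentElem
  have ht' : t * t = t := ht.isIdempotentElem
  refine ⟨y * x, ?_, ?_⟩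
  · calc (y * x)ᴴ * (y * x) = xᴴ * (yᴴ * y) * x := by
          simp only [Matrix.conjTranspose_mul, Matrix.mul_assoc]
      _ = (xᴴ * x) * (xᴴ * x) := by rw [h3, ← h2]; simp only [Matrix.mul_assoc]
      _ = p := by rw [h1, hp']
  · calc (y * x) * (y * x)ᴴ = y * (x * xᴴ) * yᴴ := by
          simp only [Matrix.conjTranspose_mul, Matrix.mul_assoc]
      _ = (y * yᴴ) * (y * yᴴ) := by rw [h2, ← h3]; simp only [Matrix.mul_assoc]
      _ = t := by rw [h4, ht']

theorem IsStarProjection.submatrix_equiv {p : Matrix ι ι A} (hp : IsStarProjection p)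
    (e : κ ≃ ι) : IsStarProjection (p.submatrix e e) := by
  have h1 : pᴴ = p := hp.isSelfAdjoint
  have h2 : p * p = p := hp.isIdempotentElem
  refine ⟨?_, ?_⟩
  · change p.submatrix e e * p.submatrix e e = _
    rw [Matrix.submatrix_mul_equiv, h2]
  · change (p.submatrix e e)ᴴ = _
    rw [Matrix.conjTranspose_submatrix, h1]

theorem MatEquiv.submatrix {p : Matrix ι ι A} (hp : IsStarProjection p) (e : κ ≃ ι) :
    MatEquiv p (p.submatrix e e) := by
  have h1 : pᴴ = p := hp.isSelfAdjoint
  have h2 : p * p = p := hp.isIdempotentElem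
  refine ⟨p.submatrix e id, ?_, ?_⟩
  · rw [Matrix.conjTranspose_submatrix, h1, Matrix.submatrix_mul_equiv, h2, Matrix.submatrix_id_id]
  · have := Matrix.submatrix_mul_equiv p p e (Equiv.refl ι) e
    rw [h2] at this
    rw [Matrix.conjTranspose_submatrix, h1]
    exact this

/-- The orthogonal sum of two matrices. -/
def blockSum (p : Matrix ι ι A) (q : Matrix κ κ A) : Matrix (ι ⊕ κ) (ι ⊕ κ) A :=
  Matrix.fromBlocks p 0 0 q

theorem IsStarProjection.blockSum {p : Matrix ι ι A} {q : Matrix κ κ A}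
    (hp : IsStarProjection p) (hq : IsStarProjection q) : IsStarProjection (blockSum p q) := by
  have h1 : pᴴ = p := hp.isSelfAdjoint
  have h2 : p * p = p := hp.isIdempotentElem
  have h3 : qᴴ = q := hq.isSelfAdjoint
  have h4 : q * q = q := hq.isIdempotentElem
  refine ⟨?_, ?_⟩
  · change Matrix.fromBlocks p 0 0 q * Matrix.fromBlocks p 0 0 q = _
    simp [Matrix.fromBlocks_multiply, h2, h4, _root_.blockSum]
  · change (Matrix.fromBlocks p 0 0 q)ᴴ = _
    simp [Matrix.fromBlocks_conjTranspose, h1, h3, _root_.blockSum]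

theorem MatEquiv.blockSum {p : Matrix ι ι A} {q : Matrix κ κ A} {p' : Matrix μ μ A}
    {q' : Matrix ν ν A} (h : MatEquiv p p') (h' : MatEquiv q q') :
    MatEquiv (blockSum p q) (blockSum p' q') := by
  obtain ⟨x, h1, h2⟩ := h
  obtain ⟨y, h3, h4⟩ := h'
  refine ⟨Matrix.fromBlocks x 0 0 y, ?_, ?_⟩
  · simp [Matrix.fromBlocks_conjTranspose, Matrix.fromBlocks_multiply, h1, h3, _root_.blockSum]
  · simp [Matrix.fromBlocks_conjTranspose, Matrix.fromBlocks_multiply, h2, h4, _root_.blockSum]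

end Matrices

section KTheory

variable (A : Type x) [NonUnitalRing A] [StarRing A]

/-- Projections in the matrix algebras `Mₙ(A)`, for all `n`. -/
structure MatProj where
  size : ℕ
  mat : Matrix (Fin size) (Fin size) A
  isStarProjection : IsStarProjection mat

/-- Murray-von Neumann equivalence of projection matrices of all sizes. -/
def MatProj.setoid : Setoid (MatProj A) where
  r p q := MatEquiv p.mat q.mat
  iseqv :=
    { refl := fun p => .refl p.isStarProjection
      symm := fun h => h.symm
      trans := fun {p _ t} h h' => .trans p.isStarProjection t.isStarProjection h h' }

/-- The monoid of Murray-von Neumann equivalence classes of projections in matrices over `A`. -/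
def VMonoid : Type x := Quotient (MatProj.setoid A)

variable {A}

/-- The orthogonal sum of two projection matrices. -/
def MatProj.sum (p q : MatProj A) : MatProj A where
  size := p.size + q.size
  mat := (blockSum p.mat q.mat).submatrix finSumFinEquiv.symm finSumFinEquiv.symm
  isStarProjection := (p.isStarProjection.blockSum q.isStarProjection).submatrix_equiv _

theorem MatProj.sum_equiv (p q : MatProj A) : MatEquiv (p.sum q).mat (blockSum p.mat q.mat) :=
  (MatEquiv.submatrix (p.isStarProjection.blockSum q.isStarProjection) _).symm

/-- The projection of size zero. -/
def MatProj.empty : MatProj A where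
  size := 0
  mat := 0
  isStarProjection := ⟨Subsingleton.elim _ _, Subsingleton.elim _ _⟩

namespace VMonoid

def mk (p : MatProj A) : VMonoid A := Quotient.mk (MatProj.setoid A) p

theorem mk_eq {p q : MatProj A} (h : MatEquiv p.mat q.mat) : mk p = mk q :=
  Quotient.sound (s := MatProj.setoid A) h

theorem mk_eq_iff {p q : MatProj A} : mk p = mk q ↔ MatEquiv p.mat q.mat :=
  ⟨fun h => Quotient.exact (s := MatProj.setoid A) h, mk_eq⟩

instance : Zero (VMonoid A) := ⟨mk .empty⟩

instance : Add (VMonoid A) :=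
  ⟨Quotient.map₂ MatProj.sum fun p p' h q q' h' =>
    MatEquiv.trans (p.sum q).isStarProjection (p'.sum q').isStarProjection (p.sum_equiv q)
      (MatEquiv.trans (p.isStarProjection.blockSum q.isStarProjection)
        (p'.sum q').isStarProjection (MatEquiv.blockSum h h') (p'.sum_equiv q').symm)⟩

theorem mk_add_mk (p q : MatProj A) : mk p + mk q = mk (p.sum q) := rfl

theorem mk_add_mk_eq {p q t : MatProj A} (h : MatEquiv (blockSum p.mat q.mat) t.mat) :
    mk p + mk q = mk t :=
  mk_eq (.trans (p.sum q).isStarProjection t.isStarProjection (p.sum_equiv q) h)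

instance : AddCommMonoid (VMonoid A) where
  nsmul := nsmulRec
  add_comm := by
    rintro ⟨p⟩ ⟨q⟩
    have hq := q.isStarProjection.blockSum p.isStarProjection
    refine mk_add_mk_eq (p := p) (q := q) (t := q.sum p)
      (.trans (p.isStarProjection.blockSum q.isStarProjection) (q.sum p).isStarProjection ?_
        (q.sum_equiv p).symm)
    have h := MatEquiv.submatrix hq (Equiv.sumComm (Fin p.size) (Fin q.size))
    convert! h.symm using 1
    ext (i | i) (j | j) <;> rfl
  zero_add := by
    rintro ⟨p⟩
    refine mk_add_mk_eq (p := MatProj.empty) (q := p) (t := p) ?_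
    have h := MatEquiv.submatrix p.isStarProjection (Equiv.emptySum (Fin 0) (Fin p.size))
    convert! h.symm using 1
    ext (i | i) (j | j)
    · exact i.elim0
    · exact i.elim0
    · exact j.elim0
    · rfl
  add_zero := by
    rintro ⟨p⟩
    refine mk_add_mk_eq (p := p) (q := MatProj.empty) (t := p) ?_
    have h := MatEquiv.submatrix p.isStarProjection (Equiv.sumEmpty (Fin p.size) (Fin 0))
    convert! h.symm using 1
    ext (i | i) (j | j)
    · rfl
    · exact j.elim0
    · exact i.elim0
    · exact i.elim0
  add_assoc := by
    rintro ⟨p⟩ ⟨q⟩ ⟨t⟩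
    have hp := p.isStarProjection
    have hq := q.isStarProjection
    have ht := t.isStarProjection
    have e1 : MatEquiv ((p.sum q).sum t).mat (blockSum (blockSum p.mat q.mat) t.mat) :=
      .trans ((p.sum q).sum t).isStarProjection ((hp.blockSum hq).blockSum ht)
        ((p.sum q).sum_equiv t) (.blockSum (p.sum_equiv q) (.refl ht))
    have e2 : MatEquiv (p.sum (q.sum t)).mat (blockSum p.mat (blockSum q.mat t.mat)) :=
      .trans (p.sum (q.sum t)).isStarProjection (hp.blockSum (hq.blockSum ht))
        (p.sum_equiv (q.sum t)) (.blockSum (.refl hp) (q.sum_equiv t))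
    have e3 : MatEquiv (blockSum (blockSum p.mat q.mat) t.mat)
        (blockSum p.mat (blockSum q.mat t.mat)) := by
      have h := MatEquiv.submatrix (hp.blockSum (hq.blockSum ht))
        (Equiv.sumAssoc (Fin p.size) (Fin q.size) (Fin t.size))
      convert! h.symm using 1
      ext ((i | i) | i) ((j | j) | j) <;> rfl
    exact mk_eq (p := (p.sum q).sum t) (q := p.sum (q.sum t))
      (.trans ((p.sum q).sum t).isStarProjection (p.sum (q.sum t)).isStarProjection e1
        (.trans ((hp.blockSum hq).blockSum ht) (p.sum (q.sum t)).isStarProjection e3 e2.symm))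

/-- The class of a projection of `A`, regarded as a matrix of size one. -/
def ofProj (p : A) (hp : IsStarProjection p) : VMonoid A :=
  mk
    { size := 1
      mat := Matrix.of fun _ _ => p
      isStarProjection := by
        have h1 : star p = p := hp.isSelfAdjoint
        have h2 : p * p = p := hp.isIdempotentElem
        refine ⟨?_, ?_⟩
        · ext i j
          simp [Matrix.mul_apply, h2]
        · ext i j
          simp [Matrix.star_apply, h1] }

theorem ofProj_eq {p q : A} (hp : IsStarProjection p) (hq : IsStarProjection q) (y : A)
    (h1 : star y * y = p) (h2 : y * star y = q) : ofProj p hp = ofProj q hq := by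
  refine mk_eq ⟨Matrix.of fun _ _ => y, ?_, ?_⟩
  · ext i j
    simp [Matrix.mul_apply, h1]
  · ext i j
    simp [Matrix.mul_apply, h2]

theorem ofProj_add {p q : A} (hp : IsStarProjection p) (hq : IsStarProjection q)
    (hpq : p * q = 0) (h : IsStarProjection (p + q)) :
    ofProj p hp + ofProj q hq = ofProj (p + q) h := by
  have h1 : star p = p := hp.isSelfAdjoint
  have h2 : p * p = p := hp.isIdempotentElem
  have h3 : star q = q := hq.isSelfAdjoint
  have h4 : q * q = q := hq.isIdempotentElem
  have hqp : q * p = 0 := by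
    have := congrArg star hpq
    rwa [star_mul, h1, h3, star_zero] at this
  refine mk_add_mk_eq (MatEquiv.symm
    ⟨Matrix.of (Sum.elim (fun _ _ => p) (fun _ _ => q)), ?_, ?_⟩)
  · ext i j
    simp [Matrix.mul_apply, h1, h2, h3, h4]
  · ext (i | i) (j | j) <;>
      simp [Matrix.mul_apply, blockSum, h1, h2, h3, h4, hpq, hqp, Subsingleton.elim i j]

theorem ofProj_zero : ofProj (0 : A) ⟨mul_zero _, star_zero _⟩ = 0 := by
  refine mk_eq ⟨0, ?_, ?_⟩
  · ext i j
    simp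
  · ext i j
    exact i.elim0

section Map

variable {ℓ : Type w} [Monoid ℓ] {B : Type v} [NonUnitalRing B] [StarRing B]
  [DistribMulAction ℓ A] [DistribMulAction ℓ B]

theorem map_mul_matrix (φ : A →⋆ₙₐ[ℓ] B) {ι κ μ : Type} [Fintype κ]
    (a : Matrix ι κ A) (b : Matrix κ μ A) : (a * b).map φ = a.map φ * b.map φ := by
  ext i j
  simp [Matrix.mul_apply, map_sum, map_mul]

theorem map_conjTranspose (φ : A →⋆ₙₐ[ℓ] B) {ι κ : Type} (a : Matrix ι κ A) :
    aᴴ.map φ = (a.map φ)ᴴ := by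
  ext i j
  simp [map_star]

/-- A `*`-homomorphism, not necessarily unital, applied to the entries of a projection. -/
def _root_.MatProj.map (φ : A →⋆ₙₐ[ℓ] B) (p : MatProj A) : MatProj B where
  size := p.size
  mat := p.mat.map φ
  isStarProjection := by
    have h1 : p.matᴴ = p.mat := p.isStarProjection.isSelfAdjoint
    have h2 : p.mat * p.mat = p.mat := p.isStarProjection.isIdempotentElem
    refine ⟨?_, ?_⟩
    · change p.mat.map φ * p.mat.map φ = _
      rw [← map_mul_matrix, h2]
    · change (p.mat.map φ)ᴴ = _
      rw [← map_conjTranspose, h1]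

/-- The monoid homomorphism induced by a `*`-homomorphism. -/
def map (φ : A →⋆ₙₐ[ℓ] B) : VMonoid A →+ VMonoid B where
  toFun := Quotient.map (MatProj.map φ) fun p q => by
    rintro ⟨y, h1, h2⟩
    refine ⟨y.map φ, ?_, ?_⟩
    · change (y.map φ)ᴴ * y.map φ = p.mat.map φ
      rw [← map_conjTranspose, ← map_mul_matrix, h1]
    · change y.map φ * (y.map φ)ᴴ = q.mat.map φ
      rw [← map_conjTranspose, ← map_mul_matrix, h2]
  map_zero' := mk_eq (p := MatProj.map φ MatProj.empty) (q := MatProj.empty)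
    ⟨0, Subsingleton.elim (α := Matrix (Fin 0) (Fin 0) B) _ _,
      Subsingleton.elim (α := Matrix (Fin 0) (Fin 0) B) _ _⟩
  map_add' := by
    rintro ⟨p⟩ ⟨q⟩
    refine congrArg mk (?_ : MatProj.map φ (p.sum q) = (p.map φ).sum (q.map φ))
    have h : (blockSum p.mat q.mat).map φ = blockSum (p.mat.map φ) (q.mat.map φ) := by
      ext (i | i) (j | j) <;> simp [blockSum]
    simp only [MatProj.map, MatProj.sum, ← h]
    rfl

end Map

end VMonoid

variable (A) in
/-- The group completion of the monoid of equivalence classes of projections in matrices over `A`.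
For `A` without unit this is the right notion when `A` has enough projections as local units, as
is the case for every Leavitt path algebra. -/
abbrev KZero : Type x := Algebra.GrothendieckAddGroup (VMonoid A)

namespace KZero

/-- The class in `K₀` of a projection of `A`. -/
def ofProj (p : A) (hp : IsStarProjection p) : KZero A :=
  Algebra.GrothendieckAddGroup.of (VMonoid.ofProj p hp)

/-- The homomorphism induced in `K₀` by a `*`-homomorphism. -/
def map {ℓ : Type w} [Monoid ℓ] {B : Type v} [NonUnitalRing B] [StarRing B]
    [DistribMulAction ℓ A] [DistribMulAction ℓ B] (φ : A →⋆ₙₐ[ℓ] B) : KZero A →+ KZero B :=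
  Algebra.GrothendieckAddGroup.lift (Algebra.GrothendieckAddGroup.of.comp (VMonoid.map φ))

theorem ofProj_add {p q : A} (hp : IsStarProjection p) (hq : IsStarProjection q)
    (hpq : p * q = 0) (h : IsStarProjection (p + q)) :
    ofProj p hp + ofProj q hq = ofProj (p + q) h := by
  rw [ofProj, ofProj, ofProj, ← map_add, VMonoid.ofProj_add hp hq hpq h]

theorem ofProj_sum {ι : Type*} (f : ι → A) (hf : ∀ i, IsStarProjection (f i))
    (hf' : ∀ i j, i ≠ j → f i * f j = 0) (t : Finset ι) :
    ∃ h : IsStarProjection (∑ i ∈ t, f i), ∑ i ∈ t, ofProj (f i) (hf i) = ofProj _ h := by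
  classical
  induction t using Finset.induction_on with
  | empty =>
    refine ⟨by simp, ?_⟩
    simp only [Finset.sum_empty, ofProj, VMonoid.ofProj_zero, map_zero]
  | insert i t hi ih =>
    obtain ⟨h, ih⟩ := ih
    have hz : f i * ∑ j ∈ t, f j = 0 := by
      rw [Finset.mul_sum]
      exact Finset.sum_eq_zero fun j hj => hf' i j fun hij => hi (hij ▸ hj)
    have hs : IsStarProjection (f i + ∑ j ∈ t, f j) := (hf i).add h hz
    refine ⟨by rw [Finset.sum_insert hi]; exact hs, ?_⟩
    simp only [Finset.sum_insert hi]
    rw [ih, ofProj_add (hf i) h hz hs]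

end KZero

end KTheory

/-! ### The canonical map from the Bowen-Franks group -/

namespace Leavitt

variable (ℓ : Type w) [CommRing ℓ] [StarRing ℓ] {V : Type u} {E : Type v} (G : DirGraph V E)

/-- The class of a vertex in the `K₀` of the Leavitt path algebra. -/
def vertexClass (a : V) : KZero (Leavitt ℓ G) :=
  KZero.ofProj (vertex ℓ G a) (isStarProjection_vertex ℓ G a)

theorem isStarProjection_edge_mul_ghost (e : E) :
    IsStarProjection (edge ℓ G e * ghost ℓ G e) := by
  refine ⟨?_, ?_⟩
  · change edge ℓ G e * ghost ℓ G e * (edge ℓ G e * ghost ℓ G e) = _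
    rw [mul_assoc, ← mul_assoc (ghost ℓ G e), ghost_mul_self, range_mul_ghost]
  · change star (edge ℓ G e * ghost ℓ G e) = _
    rw [star_mul, star_edge, star_ghost]

theorem vertexClass_eq_sum {a : V} (ha : G.IsRegular a) :
    vertexClass ℓ G a = ∑ e ∈ ha.finite.toFinset, vertexClass ℓ G (G.r e) := by
  obtain ⟨h, hs⟩ := KZero.ofProj_sum (fun e => edge ℓ G e * ghost ℓ G e)
    (isStarProjection_edge_mul_ghost ℓ G)
    (fun e f hef => by
      rw [mul_assoc, ← mul_assoc (ghost ℓ G e), ghost_mul_ne ℓ G hef, zero_mul, mul_zero])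
    ha.finite.toFinset
  have h1 (e : E) : vertexClass ℓ G (G.r e) =
      KZero.ofProj (edge ℓ G e * ghost ℓ G e) (isStarProjection_edge_mul_ghost ℓ G e) :=
    congrArg Algebra.GrothendieckAddGroup.of
      (VMonoid.ofProj_eq _ _ (edge ℓ G e) (ghost_mul_self ℓ G e) rfl)
  simp only [h1]
  rw [hs]
  simp only [vertexClass, vertex_eq_sum ℓ G ha]

/-- The canonical homomorphism from the Bowen-Franks group of `G` to the `K₀` of its Leavitt path
algebra, sending the class of a vertex to the class of that vertex. -/
def can : G.BowenFranks →+ KZero (Leavitt ℓ G) :=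
  (Submodule.liftQ (LinearMap.range G.oneSubIncidenceTranspose)
    (Finsupp.linearCombination ℤ (vertexClass ℓ G)) (by
      rintro _ ⟨y, rfl⟩
      rw [LinearMap.mem_ker]
      induction y using Finsupp.induction_linear with
      | zero => simp
      | add f g hf hg => rw [map_add, map_add, hf, hg, add_zero]
      | single a n =>
        rw [DirGraph.oneSubIncidenceTranspose, Finsupp.linearCombination_single, map_smul,
          DirGraph.incidence_column, map_sub, map_sum]
        simp only [Finsupp.linearCombination_single, one_smul]
        rw [vertexClass_eq_sum ℓ G a.2, sub_self, smul_zero])).toAddMonoidHom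

theorem can_bfClass (a : V) : can ℓ G (G.bfClass a) = vertexClass ℓ G a := by
  simp [can, DirGraph.bfClass]

end Leavitt

/-! ### Very full projections and homomorphisms -/

section VeryFull

variable {R : Type x} [Ring R] [StarRing R]

variable (R) in
/-- A unital `*`-algebra is strictly properly infinite if it contains two orthogonal isometries. -/
def IsStrictlyProperlyInfinite : Prop :=
  ∃ s t : R, star s * s = 1 ∧ star t * t = 1 ∧ star s * t = 0

/-- Murray-von Neumann equivalence of elements. -/
def MvNEquiv (p q : R) : Prop := ∃ y : R, star y * y = p ∧ y * star y = q

/-- A projection is very full if it dominates a projection equivalent to `1`. -/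
def IsVeryFullProjection (p : R) : Prop :=
  IsStarProjection p ∧ ∃ q : R, IsStarProjection q ∧ q = p * q ∧ q = q * p ∧ MvNEquiv q 1

/-- A homomorphism from a Leavitt path algebra is very full if it maps all the `e e*`, for `e` an
edge, and all the singular vertices to very full projections. -/
def IsVeryFullHom {ℓ : Type w} [CommRing ℓ] [StarRing ℓ] [Algebra ℓ R] {V : Type u} {E : Type v}
    {G : DirGraph V E} (φ : Leavitt ℓ G →⋆ₙₐ[ℓ] R) : Prop :=
  (∀ e : E, IsVeryFullProjection (φ (Leavitt.edge ℓ G e * star (Leavitt.edge ℓ G e)))) ∧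
    ∀ a : V, G.IsSingular a → IsVeryFullProjection (φ (Leavitt.vertex ℓ G a))

end VeryFull

end

/-! In a strictly properly infinite `R`, very full projections up to Murray-von Neumann equivalence
are exactly `K₀(R)` (Cuntz): every class has a very full representative, and very full projections
with the same class are equivalent. Both facts come from two orthogonal isometries `s`, `t`. Write
`u = [1]`. The complement of `ss* + tt*` gives a class `c` with `u = u + (u + c)` in the monoid, so
`u + c = 0` in `K₀`. This makes differences of classes representable by sums
(`exists_veryFull_kZero`). A class of the form `u + d` absorbs `u + c`, and adding `u` is therefore
injective on such classes; that turns stable equality into equivalence (`mvNEquiv_of_kZero_eq`).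

The isometries `sⁿt` are pairwise orthogonal, so a very full `p` dominates countably many orthogonal
very full projections of arbitrary classes (`exists_orthogonal`). If the family is finite, nonempty,
and its classes add up to `[p]`, one member can be enlarged so that the family sums to `p`
(`exists_orthogonal_sum`).

Choose orthogonal very full `P v` of class `ξ[v]`. Below `P v` choose orthogonal very full `Q e`,
for the edges `e` leaving `v`, of class `ξ[r(e)]`. At a regular `v` they can be made to sum to `P
v`, because `[v] = ∑ [r(e)]` is the defining relation of the Bowen-Franks group. Now `P (r e)` and
`Q e` have the same class, so a partial isometry `X e` links them, and `P`, `X` satisfy the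
relations of the Leavitt path algebra. For the unital addendum the `P v` are taken to sum to `p`. -/

noncomputable section

universe u v w x

/-! ### The universal property of the Leavitt path algebra -/

section LeavittLift

variable {ℓ : Type w} [CommRing ℓ] {V : Type u} {E : Type v}
  {R : Type x} [Ring R] [StarRing R] [Algebra ℓ R]

/-- The value of a formal expression at elements of a `*`-algebra. -/
def LeavittPre.eval (P : V → R) (X : E → R) : LeavittPre ℓ V E → R
  | vertex a => P a
  | edge e => X e
  | ghost e => star (X e)
  | zero => 0
  | add f g => eval P X f + eval P X g
  | neg f => -eval P X f
  | mul f g => eval P X f * eval P X g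
  | smul c f => c • eval P X f

/-- Elements of a `*`-algebra satisfying the relations of the Leavitt path algebra. -/
structure IsLeavittFamily (G : DirGraph V E) (P : V → R) (X : E → R) : Prop where
  isStarProjection (a : V) : IsStarProjection (P a)
  orthogonal {a b : V} : a ≠ b → P a * P b = 0
  source_mul (e : E) : P (G.s e) * X e = X e
  star_mul_self (e : E) : star (X e) * X e = P (G.r e)
  mul_range (e : E) : X e * P (G.r e) = X e
  star_mul_ne {e f : E} : e ≠ f → star (X e) * X f = 0
  vertex_eq_sum {a : V} (ha : G.IsRegular a) :
    P a = ∑ e ∈ ha.finite.toFinset, X e * star (X e)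

variable {G : DirGraph V E} {P : V → R} {X : E → R}

theorem LeavittPre.eval_sumRangeProj (l : List E) :
    (sumRangeProj l : LeavittPre ℓ V E).eval P X = (l.map fun e => X e * star (X e)).sum := by
  induction l with
  | nil => rfl
  | cons e l ih => rw [List.map_cons, List.sum_cons, ← ih]; rfl

theorem IsLeavittFamily.eval_eq (h : IsLeavittFamily G P X) {f g : LeavittPre ℓ V E}
    (hfg : LeavittPre.Rel G f g) : f.eval P X = g.eval P X := by
  classical
  induction hfg with
  | symm _ ih => exact ih.symm
  | add_left g _ ih => simp only [LeavittPre.eval, ih]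
  | add_right f _ ih => simp only [LeavittPre.eval, ih]
  | neg _ ih => simp only [LeavittPre.eval, ih]
  | mul_left g _ ih => simp only [LeavittPre.eval, ih]
  | mul_right f _ ih => simp only [LeavittPre.eval, ih]
  | smul c _ ih => simp only [LeavittPre.eval, ih]
  | add_assoc f g h => exact add_assoc _ _ _
  | add_comm f g => exact add_comm _ _
  | zero_add f => exact zero_add _
  | neg_add f => exact neg_add_cancel _
  | mul_assoc f g h => exact mul_assoc _ _ _
  | mul_add f g h => exact mul_add _ _ _
  | add_mul f g h => exact add_mul _ _ _
  | smul_add c f g => exact smul_add _ _ _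
  | add_smul c d f => exact add_smul _ _ _
  | mul_smul c d f => exact mul_smul _ _ _
  | one_smul f => exact one_smul _ _
  | smul_mul c f g => exact smul_mul_assoc _ _ _
  | mul_smul_comm c f g => exact mul_smul_comm _ _ _
  | vertex_mul_self a => exact (h.isStarProjection a).isIdempotentElem
  | vertex_mul_ne a b hab => exact h.orthogonal hab
  | source_mul_edge e => exact h.source_mul e
  | edge_mul_range e => exact h.mul_range e
  | range_mul_ghost e =>
    -- A family records only the relations for edges; those for phantom edges are their adjoints.
    have := congrArg star (h.mul_range e)
    rwa [star_mul, (h.isStarProjection _).isSelfAdjoint.star_eq] at this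
  | ghost_mul_source e =>
    have := congrArg star (h.source_mul e)
    rwa [star_mul, (h.isStarProjection _).isSelfAdjoint.star_eq] at this
  | ghost_mul_self e => exact h.star_mul_self e
  | ghost_mul_ne e f hef => exact h.star_mul_ne hef
  | vertex_eq_sum a l ha hl hl' =>
    have hl'' : ha.finite.toFinset = l.toFinset := by
      ext e
      simp [DirGraph.emitted, hl']
    rw [LeavittPre.eval_sumRangeProj, ← List.sum_toFinset _ hl, ← hl'']
    exact h.vertex_eq_sum ha

theorem IsLeavittFamily.eval_adj [StarRing ℓ] [StarModule ℓ R] (h : IsLeavittFamily G P X)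
    (f : LeavittPre ℓ V E) : f.adj.eval P X = star (f.eval P X) := by
  induction f with
  | vertex a => exact (h.isStarProjection a).isSelfAdjoint.star_eq.symm
  | edge e => rfl
  | ghost e => exact (star_star _).symm
  | zero => exact (star_zero _).symm
  | add f g hf hg => simp only [LeavittPre.adj, LeavittPre.eval, hf, hg, star_add]
  | neg f hf => simp only [LeavittPre.adj, LeavittPre.eval, hf, star_neg]
  | mul f g hf hg => simp only [LeavittPre.adj, LeavittPre.eval, hf, hg, star_mul]
  | smul c f hf => simp only [LeavittPre.adj, LeavittPre.eval, hf, star_smul]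

variable (ℓ) in
/-- The `*`-homomorphism defined by a family satisfying the relations of `L(G)`. -/
def Leavitt.lift [StarRing ℓ] [StarModule ℓ R] (h : IsLeavittFamily G P X) :
    Leavitt ℓ G →⋆ₙₐ[ℓ] R where
  toFun := Quot.lift (LeavittPre.eval P X) fun _ _ hfg => h.eval_eq hfg
  map_smul' := by rintro c ⟨f⟩; rfl
  map_zero' := rfl
  map_add' := by rintro ⟨f⟩ ⟨g⟩; rfl
  map_mul' := by rintro ⟨f⟩ ⟨g⟩; rfl
  map_star' := by rintro ⟨f⟩; exact h.eval_adj f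

theorem Leavitt.lift_edge [StarRing ℓ] [StarModule ℓ R] (h : IsLeavittFamily G P X) (e : E) :
    lift ℓ h (edge ℓ G e) = X e := rfl

end LeavittLift

/-! ### Induced maps on `K₀` and the presentation of the Bowen-Franks group -/

section KZeroMap

variable {A : Type x} [NonUnitalRing A] [StarRing A] {ℓ : Type w} [Monoid ℓ]
  {B : Type v} [NonUnitalRing B] [StarRing B] [DistribMulAction ℓ A] [DistribMulAction ℓ B]

theorem KZero.map_ofProj (φ : A →⋆ₙₐ[ℓ] B) {p : A} (hp : IsStarProjection p) :
    KZero.map φ (KZero.ofProj p hp) = KZero.ofProj (φ p) (hp.map φ) :=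
  DFunLike.congr_fun (Algebra.GrothendieckAddGroup.lift.symm_apply_apply
    (Algebra.GrothendieckAddGroup.of.comp (VMonoid.map φ))) (VMonoid.ofProj p hp)

theorem KZero.ofProj_congr {p q : A} (h : p = q) (hp : IsStarProjection p)
    (hq : IsStarProjection q) : ofProj p hp = ofProj q hq := by
  subst h; rfl

end KZeroMap

/-- The vertex classes generate, being the images of the basis of `ℤ^(V)`. -/
theorem DirGraph.bowenFranks_hom_ext {V : Type u} {E : Type v} {G : DirGraph V E}
    {B : Type x} [AddCommGroup B] {f g : G.BowenFranks →+ B}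
    (h : ∀ a, f (G.bfClass a) = g (G.bfClass a)) : f = g := by
  have key : f.comp (Submodule.mkQ (LinearMap.range G.oneSubIncidenceTranspose)).toAddMonoidHom =
      g.comp (Submodule.mkQ (LinearMap.range G.oneSubIncidenceTranspose)).toAddMonoidHom := by
    refine Finsupp.addHom_ext' fun a => AddMonoidHom.ext_int ?_
    exact h a
  ext y
  obtain ⟨y, rfl⟩ := Submodule.mkQ_surjective _ y
  exact DFunLike.congr_fun key y

/-- The difference of the two sides is the column of `I - Aᵗ` at `a`. -/
theorem DirGraph.bfClass_eq_sum {V : Type u} {E : Type v} (G : DirGraph V E) {a : V}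
    (ha : G.IsRegular a) : G.bfClass a = ∑ e ∈ ha.finite.toFinset, G.bfClass (G.r e) := by
  have h : ∑ e ∈ ha.finite.toFinset, G.bfClass (G.r e) = Submodule.Quotient.mk
      (∑ e ∈ ha.finite.toFinset, Finsupp.single (G.r e) (1 : ℤ)) :=
    (map_sum (Submodule.mkQ (LinearMap.range G.oneSubIncidenceTranspose)) _ _).symm
  rw [h, bfClass, Submodule.Quotient.eq]
  refine ⟨Finsupp.single ⟨a, ha⟩ 1, ?_⟩
  rw [oneSubIncidenceTranspose, Finsupp.linearCombination_single, one_smul, incidence_column]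

/-! ### Projections in strictly properly infinite algebras -/

section ProperlyInfinite

variable {R : Type x} [Ring R] [StarRing R]

theorem IsStarProjection.mul_eq_zero_comm {p q : R} (hp : IsStarProjection p)
    (hq : IsStarProjection q) (h : p * q = 0) : q * p = 0 := by
  have := congrArg star h
  rwa [star_mul, hp.isSelfAdjoint.star_eq, hq.isSelfAdjoint.star_eq, star_zero] at this

/-- The conjugate of a projection by an isometry. -/
theorem IsStarProjection.conj_isometry {p y : R} (hp : IsStarProjection p)
    (hy : star y * y = 1) : IsStarProjection (y * p * star y) := by
  have h1 : p * p = p := hp.isIdempotentElem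
  have h2 : star p = p := hp.isSelfAdjoint
  refine ⟨?_, ?_⟩
  · calc y * p * star y * (y * p * star y) = y * p * (star y * y) * p * star y := by noncomm_ring
      _ = y * p * star y := by rw [hy, mul_one, mul_assoc y p p, h1]
  · change star _ = _
    simp only [star_mul, star_star, h2, mul_assoc]

theorem MvNEquiv.conj_isometry {p y : R} (hp : IsStarProjection p) (hy : star y * y = 1) :
    MvNEquiv p (y * p * star y) := by
  have h1 : p * p = p := hp.isIdempotentElem
  have h2 : star p = p := hp.isSelfAdjoint
  refine ⟨y * p, ?_, ?_⟩
  · rw [star_mul, h2, mul_assoc, ← mul_assoc _ y, hy, one_mul, h1]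
  · rw [star_mul, h2, mul_assoc, ← mul_assoc p, h1, mul_assoc]

theorem MvNEquiv.symm {p q : R} (h : MvNEquiv p q) : MvNEquiv q p := by
  obtain ⟨y, h1, h2⟩ := h
  exact ⟨star y, by rwa [star_star], by rwa [star_star]⟩

theorem MvNEquiv.trans {p q r : R} (hp : IsStarProjection p) (hr : IsStarProjection r)
    (h : MvNEquiv p q) (h' : MvNEquiv q r) : MvNEquiv p r := by
  obtain ⟨y, h1, h2⟩ := h
  obtain ⟨z, h3, h4⟩ := h'
  have hp' : p * p = p := hp.isIdempotentElem
  have hr' : r * r = r := hr.isIdempotentElem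
  refine ⟨z * y, ?_, ?_⟩
  · calc star (z * y) * (z * y) = star y * (star z * z) * y := by
          simp only [star_mul, mul_assoc]
      _ = (star y * y) * (star y * y) := by rw [h3, ← h2]; simp only [mul_assoc]
      _ = p := by rw [h1, hp']
  · calc (z * y) * star (z * y) = z * (y * star y) * star z := by
          simp only [star_mul, mul_assoc]
      _ = (z * star z) * (z * star z) := by rw [h2, ← h3]; simp only [mul_assoc]
      _ = r := by rw [h4, hr']

/-- Equivalent projections are linked by a partial isometry between them. -/
theorem MvNEquiv.exists_partial_isometry {p q : R} (hp : IsStarProjection p)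
    (hq : IsStarProjection q) (h : MvNEquiv p q) :
    ∃ y : R, star y * y = p ∧ y * star y = q ∧ y * p = y ∧ q * y = y := by
  obtain ⟨y, h1, h2⟩ := h
  have h3 : p * p = p := hp.isIdempotentElem
  have h4 : star p = p := hp.isSelfAdjoint
  have h5 : q * q = q := hq.isIdempotentElem
  -- Both sides are `y * star y * y`. Cutting `y` down to `y * p` thus fixes both supports at once.
  have hy : q * y = y * p := by rw [← h1, ← h2, mul_assoc]
  refine ⟨y * p, ?_, ?_, ?_, ?_⟩
  · rw [star_mul, h4, mul_assoc, ← mul_assoc (star y), h1, h3, h3]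
  · rw [star_mul, h4, mul_assoc, ← mul_assoc p, h3, ← mul_assoc, ← hy, mul_assoc, h2, h5]
  · rw [mul_assoc, h3]
  · rw [← mul_assoc, hy, mul_assoc, h3]

theorem VMonoid.ofProj_eq_of_mvNEquiv {p q : R} (hp : IsStarProjection p)
    (hq : IsStarProjection q) (h : MvNEquiv p q) : ofProj p hp = ofProj q hq := by
  obtain ⟨y, h1, h2⟩ := h
  exact ofProj_eq hp hq y h1 h2

/-- An equivalence between matrices of size one is itself a matrix of size one, so no stabilisation
has to be undone. -/
theorem VMonoid.mvNEquiv_of_ofProj_eq {p q : R} {hp : IsStarProjection p}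
    {hq : IsStarProjection q} (h : ofProj p hp = ofProj q hq) : MvNEquiv p q := by
  obtain ⟨y, h1, h2⟩ := mk_eq_iff.1 h
  refine ⟨y 0 0, ?_, ?_⟩
  · simpa [Matrix.mul_apply] using congrFun (congrFun h1 0) 0
  · simpa [Matrix.mul_apply] using congrFun (congrFun h2 0) 0

theorem KZero.ofProj_eq_of_mvNEquiv {p q : R} (hp : IsStarProjection p)
    (hq : IsStarProjection q) (h : MvNEquiv p q) : ofProj p hp = ofProj q hq :=
  congrArg _ (VMonoid.ofProj_eq_of_mvNEquiv hp hq h)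

theorem IsVeryFullProjection.one : IsVeryFullProjection (1 : R) :=
  ⟨.one R, 1, .one R, by simp, by simp, 1, by simp, by simp⟩

theorem IsVeryFullProjection.conj_isometry {p y : R} (hp : IsVeryFullProjection p)
    (hy : star y * y = 1) : IsVeryFullProjection (y * p * star y) := by
  obtain ⟨hp, q, hq, h1, h2, h3⟩ := hp
  refine ⟨hp.conj_isometry hy, y * q * star y, hq.conj_isometry hy, ?_, ?_,
    (MvNEquiv.conj_isometry hq hy).symm.trans (hq.conj_isometry hy) (.one R) h3⟩
  · calc y * q * star y = y * (p * q) * star y := by rw [← h1]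
      -- The inserted `1` becomes `star y * y`.
      _ = y * p * 1 * q * star y := by noncomm_ring
      _ = y * p * star y * (y * q * star y) := by rw [← hy]; noncomm_ring
  · calc y * q * star y = y * (q * p) * star y := by rw [← h2]
      _ = y * q * 1 * p * star y := by noncomm_ring
      _ = y * q * star y * (y * p * star y) := by rw [← hy]; noncomm_ring

theorem IsVeryFullProjection.of_le {p q : R} (hp : IsVeryFullProjection p)
    (hq : IsStarProjection q) (hqp : q * p = p) : IsVeryFullProjection q := by
  obtain ⟨hp, r, hr, h1, h2, h3⟩ := hp
  have hpq : p * q = p := by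
    have := congrArg star hqp
    rwa [star_mul, hp.isSelfAdjoint.star_eq, hq.isSelfAdjoint.star_eq] at this
  refine ⟨hq, r, hr, ?_, ?_, h3⟩
  · rw [h1, ← mul_assoc, hqp]
  · rw [h2, mul_assoc, hpq]

/-- A very full projection dominates the range of an isometry. -/
theorem IsVeryFullProjection.exists_isometry {p : R} (hp : IsVeryFullProjection p) :
    ∃ y : R, star y * y = 1 ∧ p * y = y := by
  obtain ⟨hp, q, hq, h1, h2, h3⟩ := hp
  obtain ⟨y, h4, -, -, h7⟩ := h3.symm.exists_partial_isometry (.one R) hq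
  exact ⟨y, h4, by rw [← h7, ← mul_assoc, ← h1]⟩

theorem IsVeryFullProjection.of_isometry {p y : R} (hp : IsStarProjection p)
    (hy : star y * y = 1) (hpy : p * y = y) : IsVeryFullProjection p := by
  refine (IsVeryFullProjection.one.conj_isometry hy).of_le hp ?_
  rw [← mul_assoc, ← mul_assoc, hpy]

/-! ### Orthogonal isometries and compression of matrices -/

variable {s t : R}

theorem star_pow_mul_pow_add (hs : star s * s = 1) (m n : ℕ) :
    star (s ^ m) * s ^ (m + n) = s ^ n := by
  induction m with
  | zero => simp
  | succ m ih =>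
    rw [pow_succ', star_mul, show m + 1 + n = (m + n) + 1 by ring, pow_succ' s (m + n), mul_assoc,
      ← mul_assoc (star s), hs, one_mul, ih]

theorem star_pow_mul_self (hs : star s * s = 1) (ht : star t * t = 1) (n : ℕ) :
    star (s ^ n * t) * (s ^ n * t) = 1 := by
  have h := star_pow_mul_pow_add hs n 0
  rw [add_zero, pow_zero] at h
  rw [star_mul, mul_assoc, ← mul_assoc _ _ t, h, one_mul, ht]

/-- After cancelling the common power of `s`, what remains is `t*` next to a positive power of `s`,
and `t* s = 0`; the case `m > n` is the adjoint. -/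
theorem star_pow_mul_ne (hs : star s * s = 1) (hst : star s * t = 0) {m n : ℕ} (h : m ≠ n) :
    star (s ^ m * t) * (s ^ n * t) = 0 := by
  have key (m k : ℕ) : star (s ^ m * t) * (s ^ (m + (k + 1)) * t) = 0 := by
    have hts : star t * s = 0 := by simpa using congrArg star hst
    rw [star_mul, mul_assoc, ← mul_assoc _ _ t, star_pow_mul_pow_add hs, pow_succ', ← mul_assoc,
      ← mul_assoc, hts, zero_mul, zero_mul]
  rcases lt_or_gt_of_ne h with h | h
  · obtain ⟨k, rfl⟩ := Nat.exists_eq_add_of_lt h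
    exact key m k
  · obtain ⟨k, rfl⟩ := Nat.exists_eq_add_of_lt h
    simpa [add_assoc] using congrArg star (key n k)

/-- A strictly properly infinite algebra contains a sequence of orthogonal isometries. -/
theorem IsStrictlyProperlyInfinite.exists_isometries (hR : IsStrictlyProperlyInfinite R) :
    ∃ y : ℕ → R, (∀ n, star (y n) * y n = 1) ∧ ∀ m n, m ≠ n → star (y m) * y n = 0 := by
  obtain ⟨s, t, hs, ht, hst⟩ := hR
  exact ⟨fun n => s ^ n * t, star_pow_mul_self hs ht, fun _ _ h => star_pow_mul_ne hs hst h⟩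

/-- Every class of projection matrices is the class of a projection of `R`. -/
theorem IsStrictlyProperlyInfinite.exists_ofProj_eq (hR : IsStrictlyProperlyInfinite R)
    (c : VMonoid R) : ∃ (p : R) (hp : IsStarProjection p), VMonoid.ofProj p hp = c := by
  obtain ⟨y, h1, h2⟩ := hR.exists_isometries
  obtain ⟨P⟩ := c
  -- A row of orthogonal isometries satisfies `Sᴴ * S = 1`, so `S P Sᴴ` is a copy of `P` of size
  -- one.
  let S : Matrix (Fin 1) (Fin P.size) R := Matrix.of fun _ j => y j
  have hS : Sᴴ * S = 1 := by
    ext i j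
    by_cases hij : i = j
    · subst hij
      simp [S, Matrix.mul_apply, h1]
    · simp [S, Matrix.mul_apply, hij, h2 i j (fun h => hij (Fin.ext h))]
  have hP1 : P.matᴴ = P.mat := P.isStarProjection.isSelfAdjoint
  have hP2 : P.mat * P.mat = P.mat := P.isStarProjection.isIdempotentElem
  have e1 : (S * P.mat)ᴴ * (S * P.mat) = P.mat := by
    rw [Matrix.conjTranspose_mul, hP1, Matrix.mul_assoc, ← Matrix.mul_assoc Sᴴ, hS,
      Matrix.one_mul, hP2]
  have e2 : (S * P.mat) * (S * P.mat)ᴴ * ((S * P.mat) * (S * P.mat)ᴴ) =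
      (S * P.mat) * (S * P.mat)ᴴ := by
    rw [Matrix.mul_assoc, ← Matrix.mul_assoc (S * P.mat)ᴴ, e1, ← Matrix.mul_assoc,
      Matrix.mul_assoc S, hP2]
  let Q : Matrix (Fin 1) (Fin 1) R := (S * P.mat) * (S * P.mat)ᴴ
  have hQ : IsStarProjection (Q 0 0) := by
    refine ⟨?_, ?_⟩
    · change Q 0 0 * Q 0 0 = Q 0 0
      have : Q * Q = Q := e2
      simpa only [Matrix.mul_apply, Fin.sum_univ_one] using congrFun (congrFun this 0) 0
    · have : Qᴴ = Q := by simp [Q]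
      exact congrFun (congrFun this 0) 0
  refine ⟨Q 0 0, hQ, VMonoid.mk_eq (MatEquiv.symm ⟨S * P.mat, e1, ?_⟩)⟩
  ext i j
  rw [Subsingleton.elim i 0, Subsingleton.elim j 0]
  rfl

-- `K₀` in terms of very full projections

local notation "unitClass" => VMonoid.ofProj (1 : R) (IsStarProjection.one R)

/-- The ranges `ss*` and `tt*` are orthogonal copies of `1`, and `c` is the class of what they leave
over. In `K₀` this makes `c` the negative of the class of `1`. -/
theorem IsStrictlyProperlyInfinite.exists_unit_eq (hR : IsStrictlyProperlyInfinite R) :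
    ∃ c : VMonoid R, unitClass = unitClass + (unitClass + c) := by
  obtain ⟨s, t, hs, ht, hst⟩ := hR
  have hp : IsStarProjection (s * star s) := by
    simpa using (IsStarProjection.one R).conj_isometry hs
  have hq : IsStarProjection (t * star t) := by
    simpa using (IsStarProjection.one R).conj_isometry ht
  have hpq : s * star s * (t * star t) = 0 := by
    rw [mul_assoc, ← mul_assoc (star s), hst, zero_mul, mul_zero]
  have hadd := hp.add hq hpq
  have ep : VMonoid.ofProj _ hp = unitClass :=
    VMonoid.ofProj_eq _ _ (star s) (by simp) (by simpa using hs)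
  have eq : VMonoid.ofProj _ hq = unitClass :=
    VMonoid.ofProj_eq _ _ (star t) (by simp) (by simpa using ht)
  refine ⟨VMonoid.ofProj _ hadd.one_sub, ?_⟩
  have h1 := VMonoid.ofProj_add hp hq hpq hadd
  have h2 := VMonoid.ofProj_add hadd hadd.one_sub hadd.mul_one_sub_self (by simp)
  rw [ep, eq] at h1
  rw [← add_assoc, h1, h2]
  simp

/-- The summand `c` is the class of `p - q`, where `q ∼ 1` lies below `p`. -/
theorem IsVeryFullProjection.exists_class_eq {p : R} (hp : IsVeryFullProjection p) :
    ∃ c : VMonoid R, VMonoid.ofProj p hp.1 = unitClass + c := by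
  obtain ⟨hp', q, hq, h1, h2, h3⟩ := hp
  have hd := hq.sub_of_mul_eq_left hp' h2.symm
  refine ⟨VMonoid.ofProj _ hd, ?_⟩
  have hz : q * (p - q) = 0 := by
    rw [mul_sub, ← h2, hq.isIdempotentElem.eq, sub_self]
  rw [← VMonoid.ofProj_eq_of_mvNEquiv hq (.one R) h3,
    VMonoid.ofProj_add hq hd hz (by simpa using hp')]
  simp

/-- If `d` represents `c`, then `ss* + t d t*` works: its first summand is the range of an isometry.
-/
theorem IsStrictlyProperlyInfinite.exists_veryFull (hR : IsStrictlyProperlyInfinite R)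
    (c : VMonoid R) :
    ∃ (p : R) (hp : IsVeryFullProjection p), VMonoid.ofProj p hp.1 = unitClass + c := by
  obtain ⟨d, hd, rfl⟩ := hR.exists_ofProj_eq c
  obtain ⟨s, t, hs, ht, hst⟩ := hR
  have hp : IsStarProjection (s * 1 * star s) := (IsStarProjection.one R).conj_isometry hs
  have hq := hd.conj_isometry ht
  have hpq : s * 1 * star s * (t * d * star t) = 0 := by
    calc _ = s * (star s * t) * d * star t := by noncomm_ring
      _ = 0 := by rw [hst]; simp
  have hadd := hp.add hq hpq
  have hts : star t * s = 0 := by simpa using congrArg star hst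
  refine ⟨_, .of_isometry hadd hs ?_, ?_⟩
  · rw [add_mul, mul_assoc _ _ s, mul_assoc _ _ s, hs, hts]
    simp
  · rw [← VMonoid.ofProj_add hp hq hpq,
      ← VMonoid.ofProj_eq_of_mvNEquiv _ hp (MvNEquiv.conj_isometry (.one R) hs),
      ← VMonoid.ofProj_eq_of_mvNEquiv _ hq (MvNEquiv.conj_isometry hd ht)]

/-- Every class in `K₀` is the class of a very full projection. -/
theorem IsStrictlyProperlyInfinite.exists_veryFull_kZero (hR : IsStrictlyProperlyInfinite R)
    (z : KZero R) : ∃ (p : R) (hp : IsVeryFullProjection p), KZero.ofProj p hp.1 = z := by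
  obtain ⟨⟨a, b, _⟩, hab⟩ := (AddLocalization.addMonoidOf (⊤ : AddSubmonoid (VMonoid R))).surj z
  obtain ⟨q, hq, rfl⟩ := hR.exists_ofProj_eq b
  obtain ⟨c, hc⟩ := hR.exists_unit_eq
  have hq1 := VMonoid.ofProj_add hq hq.one_sub hq.mul_one_sub_self (by simp)
  -- Here `z = a - [q] = a + [1 - q] - [1]`, and `-[1] = c` in `K₀`. The second `c` cancels the
  -- `[1]` that `exists_veryFull` adds.
  obtain ⟨p, hp, h⟩ := hR.exists_veryFull (a + VMonoid.ofProj _ hq.one_sub + c + c)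
  refine ⟨p, hp, ?_⟩
  let o : VMonoid R →+ KZero R := Algebra.GrothendieckAddGroup.of
  have e1 : z + o (VMonoid.ofProj q hq) = o a := hab
  have e2 : o (VMonoid.ofProj q hq) + o (VMonoid.ofProj _ hq.one_sub) = o unitClass := by
    rw [← map_add, hq1]
    simp
  have e3 : o unitClass = o unitClass + (o unitClass + o c) := by
    rw [← map_add, ← map_add, ← hc]
  have e4 : o unitClass + o c = 0 := by simpa using e3
  change o (VMonoid.ofProj p hp.1) = z
  rw [h]
  simp only [map_add]
  rw [← e1]
  calc _ = z + (o (VMonoid.ofProj q hq) + o (VMonoid.ofProj _ hq.one_sub)) + o c +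
        (o unitClass + o c) := by abel
    _ = z := by rw [e2, add_assoc z, e4, add_zero, add_zero]

/-- Very full projections with the same class in `K₀` are equivalent. -/
theorem IsVeryFullProjection.mvNEquiv_of_kZero_eq (hR : IsStrictlyProperlyInfinite R) {p q : R}
    (hp : IsVeryFullProjection p) (hq : IsVeryFullProjection q)
    (h : KZero.ofProj p hp.1 = KZero.ofProj q hq.1) : MvNEquiv p q := by
  obtain ⟨⟨d, _⟩, hd⟩ :=
    (AddLocalization.addMonoidOf (⊤ : AddSubmonoid (VMonoid R))).eq_iff_exists.1 h
  replace hd : d + VMonoid.ofProj p hp.1 = d + VMonoid.ofProj q hq.1 := hd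
  obtain ⟨r, hr, rfl⟩ := hR.exists_ofProj_eq d
  obtain ⟨c, hc⟩ := hR.exists_unit_eq
  obtain ⟨a, ha⟩ := hp.exists_class_eq
  obtain ⟨b, hb⟩ := hq.exists_class_eq
  -- Adding `[1 - r]` to both sides replaces the arbitrary stabilising class `[r]` by that of `1`.
  have hr1 := VMonoid.ofProj_add hr.one_sub hr hr.one_sub_mul_self (by simp)
  simp only [sub_add_cancel] at hr1
  have hu : unitClass + VMonoid.ofProj p hp.1 = unitClass + VMonoid.ofProj q hq.1 := by
    rw [← hr1, add_assoc, add_assoc, hd]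
  -- A class above `[1]` is recovered from its sum with `[1]` by adding `c`, so `[1]` can be
  -- cancelled.
  have absorb {y d : VMonoid R} (hy : y = unitClass + d) : y = c + (unitClass + y) := by
    calc y = unitClass + (unitClass + c) + d := by rw [← hc, hy]
      _ = c + (unitClass + y) := by rw [hy]; abel
  refine VMonoid.mvNEquiv_of_ofProj_eq (hp := hp.1) (hq := hq.1) ?_
  rw [absorb ha, hu, ← absorb hb]

/-! ### Splitting very full projections -/

/-- A very full projection dominates orthogonal very full projections of prescribed classes. -/
theorem IsVeryFullProjection.exists_orthogonal (hR : IsStrictlyProperlyInfinite R) {p : R}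
    (hp : IsVeryFullProjection p) {ι : Type*} [Countable ι] (z : ι → KZero R) :
    ∃ (q : ι → R) (hq : ∀ i, IsVeryFullProjection (q i)), (∀ i j, i ≠ j → q i * q j = 0) ∧
      (∀ i, p * q i = q i) ∧ ∀ i, KZero.ofProj (q i) (hq i).1 = z i := by
  obtain ⟨y, h1, h2⟩ := hR.exists_isometries
  obtain ⟨x, hx, hpx⟩ := hp.exists_isometry
  obtain ⟨k, hk⟩ := exists_injective_nat ι
  choose r hr hz using fun i => hR.exists_veryFull_kZero (z i)
  have hxy (m n : ℕ) : star (x * y m) * (x * y n) = star (y m) * y n := by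
    rw [star_mul, mul_assoc, ← mul_assoc _ x, hx, one_mul]
  have hi (i : ι) : star (x * y (k i)) * (x * y (k i)) = 1 := by rw [hxy, h1]
  -- Since `p * x = x`, the isometries `x * y (k i)` have orthogonal ranges below `p`; each carries
  -- a representative `r i` of `z i` into its own range.
  refine ⟨fun i => x * y (k i) * r i * star (x * y (k i)),
    fun i => (hr i).conj_isometry (hi i), fun i j hij => ?_, fun i => ?_, fun i => ?_⟩
  · calc _ = x * y (k i) * r i * (star (x * y (k i)) * (x * y (k j))) * r j *
          star (x * y (k j)) := by simp only [mul_assoc]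
      _ = 0 := by rw [hxy, h2 _ _ (hk.ne hij)]; simp
  · simp only [← mul_assoc, hpx]
  · rw [← KZero.ofProj_eq_of_mvNEquiv (hr i).1 _ (MvNEquiv.conj_isometry (hr i).1 (hi i)), hz]

/-- A very full projection splits into very full projections of prescribed classes, provided that
these add up to its own class. -/
theorem IsVeryFullProjection.exists_orthogonal_sum (hR : IsStrictlyProperlyInfinite R) {p : R}
    (hp : IsVeryFullProjection p) {ι : Type*} [Fintype ι] [Nonempty ι] (z : ι → KZero R)
    (hz : KZero.ofProj p hp.1 = ∑ i, z i) :
    ∃ (q : ι → R) (hq : ∀ i, IsVeryFullProjection (q i)), (∀ i j, i ≠ j → q i * q j = 0) ∧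
      (∀ i, p * q i = q i) ∧ (∀ i, KZero.ofProj (q i) (hq i).1 = z i) ∧ ∑ i, q i = p := by
  classical
  obtain ⟨q, hq, horth, hpq, hqz⟩ := hp.exists_orthogonal hR z
  -- The projection at `o` will be enlarged to `p - r`, the complement in `p` of all the others.
  let o : ι := Classical.arbitrary ι
  have ⟨hr, hrz⟩ := KZero.ofProj_sum q (fun i => (hq i).1) horth (Finset.univ.erase o)
  set r := ∑ i ∈ Finset.univ.erase o, q i with r_def
  have hpr : p * r = r := by rw [r_def, Finset.mul_sum]; simp only [hpq]
  have hd : IsStarProjection (p - r) := hr.sub_of_mul_eq_right hp.1 hpr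
  have hro : r * q o = 0 := by
    rw [r_def, Finset.sum_mul]
    exact Finset.sum_eq_zero fun i hi => horth _ _ (Finset.ne_of_mem_erase hi)
  have hrq (i : ι) (hi : i ≠ o) : r * q i = q i := by
    rw [r_def, Finset.sum_mul, Finset.sum_eq_single i (fun j _ hj => horth _ _ hj) (by simp [hi]),
      (hq i).1.isIdempotentElem.eq]
  have hdo (i : ι) (hi : i ≠ o) : (p - r) * q i = 0 := by
    rw [sub_mul, hpq, hrq i hi, sub_self]
  -- The complement dominates the old `q o`.
  have hdf : IsVeryFullProjection (p - r) :=
    (hq o).of_le hd (by rw [sub_mul, hpq, hro, sub_zero])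
  have hcases (i : ι) : IsVeryFullProjection (if i = o then p - r else q i) := by
    split_ifs
    exacts [hdf, hq i]
  have hcongr (i : ι) (hi : i ≠ o) : (if i = o then p - r else q i) = q i := if_neg hi
  refine ⟨fun i => if i = o then p - r else q i, hcases, ?_, ?_, ?_, ?_⟩
  · intro i j hij
    by_cases hi : i = o
    · have hj : j ≠ o := fun h => hij (hi.trans h.symm)
      simp only [if_pos hi, if_neg hj, hdo j hj]
    · by_cases hj : j = o
      · simp only [if_neg hi, if_pos hj]
        exact hd.mul_eq_zero_comm (hq i).1 (hdo i hi)
      · simp only [if_neg hi, if_neg hj, horth i j hij]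
  · intro i
    by_cases hi : i = o
    · simp only [if_pos hi, mul_sub, hp.1.isIdempotentElem.eq, hpr]
    · simp only [if_neg hi, hpq]
  · intro i
    by_cases hi : i = o
    · rw [KZero.ofProj_congr (if_pos hi) (hcases i).1 hd]
      have hzr : (p - r) * r = 0 := by
        rw [sub_mul, hpr, hr.isIdempotentElem.eq, sub_self]
      -- The class of the complement is forced: `[p - r] + [r] = [p] = ∑ z i`, and `[r]` accounts
      -- for all terms but `z o`.
      have hsum := KZero.ofProj_add hd hr hzr (by simpa using hp.1)
      rw [KZero.ofProj_congr (sub_add_cancel p r) _ hp.1, hz, ← hrz,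
        ← Finset.add_sum_erase _ _ (Finset.mem_univ o)] at hsum
      simp only [hqz] at hsum
      rw [hi]
      exact add_right_cancel hsum
    · rw [KZero.ofProj_congr (if_neg hi) (hcases i).1 (hq i).1, hqz]
  · rw [← Finset.add_sum_erase _ _ (Finset.mem_univ o), if_pos rfl,
      Finset.sum_congr rfl fun i hi => hcongr i (Finset.ne_of_mem_erase hi)]
    exact sub_add_cancel p r

end ProperlyInfinite

/-! ### Construction of the homomorphism -/

section Construction

variable {ℓ : Type w} [CommRing ℓ] [StarRing ℓ] {R : Type x} [Ring R] [StarRing R] [Algebra ℓ R]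
  [StarModule ℓ R] {V : Type u} {E : Type v} [Countable E] {G : DirGraph V E}

/-- Very full projections below that of a vertex, for the edges which it emits. -/
theorem DirGraph.exists_edge_projections (hR : IsStrictlyProperlyInfinite R)
    {ξ : G.BowenFranks →+ KZero R} (a : V) {p : R} (hp : IsVeryFullProjection p)
    (hξ : KZero.ofProj p hp.1 = ξ (G.bfClass a)) :
    ∃ (q : G.emitted a → R) (hq : ∀ e, IsVeryFullProjection (q e)),
      (∀ e f, e ≠ f → q e * q f = 0) ∧ (∀ e, p * q e = q e) ∧
      (∀ e, KZero.ofProj (q e) (hq e).1 = ξ (G.bfClass (G.r e))) ∧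
      ∀ _ : G.IsRegular a, ∀ [Fintype (G.emitted a)], ∑ e, q e = p := by
  by_cases ha : G.IsRegular a
  · have := ha.finite.fintype
    have := ha.nonempty.to_subtype
    obtain ⟨q, hq, h1, h2, h3, h4⟩ := hp.exists_orthogonal_sum hR
      (fun e : G.emitted a => ξ (G.bfClass (G.r e))) (by
        rw [hξ, G.bfClass_eq_sum ha, map_sum]
        exact Finset.sum_subtype _ (by simp) _)
    exact ⟨q, hq, h1, h2, h3, fun _ _ => by convert h4⟩
  -- A singular vertex imposes no sum condition, so a merely orthogonal family suffices, be it empty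
  -- or infinite.
  · obtain ⟨q, hq, h1, h2, h3⟩ := hp.exists_orthogonal hR
      (fun e : G.emitted a => ξ (G.bfClass (G.r e)))
    exact ⟨q, hq, h1, h2, h3, fun h => absurd h ha⟩

/-- Orthogonal very full projections of the right classes are the images of the vertices under a
very full homomorphism. -/
theorem Leavitt.exists_veryFullHom (hR : IsStrictlyProperlyInfinite R)
    (ξ : G.BowenFranks →+ KZero R) {P : V → R} (hP : ∀ a, IsVeryFullProjection (P a))
    (horth : ∀ a b, a ≠ b → P a * P b = 0)
    (hξ : ∀ a, KZero.ofProj (P a) (hP a).1 = ξ (G.bfClass a)) :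
    ∃ φ : Leavitt ℓ G →⋆ₙₐ[ℓ] R, IsVeryFullHom φ ∧
      (KZero.map φ).comp (Leavitt.can ℓ G) = ξ ∧ ∀ a, φ (vertex ℓ G a) = P a := by
  choose q hq hqorth hPq hqξ hqsum using fun a => G.exists_edge_projections hR a (hP a) (hξ a)
  let Q (e : E) : R := q (G.s e) ⟨e, rfl⟩
  have hQ (e : E) : IsVeryFullProjection (Q e) := hq _ _
  have hPQ (e : E) : P (G.s e) * Q e = Q e := hPq _ _
  -- Allows an edge to be viewed at any vertex known to equal its source.
  have q_eq (a : V) (e : G.emitted a) : q a e = Q e := by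
    obtain ⟨e, rfl⟩ := e
    rfl
  have hQorth (e f : E) (hef : e ≠ f) : Q e * Q f = 0 := by
    -- Edges with a common source are orthogonal by choice; otherwise they lie below orthogonal
    -- vertex projections.
    by_cases h : G.s e = G.s f
    · rw [← q_eq (G.s f) ⟨e, h⟩, ← q_eq (G.s f) ⟨f, rfl⟩]
      exact hqorth _ _ _ fun h' => hef (congrArg Subtype.val h')
    · have hQP : Q e * P (G.s e) = Q e := by
        simpa [(hQ e).1.isSelfAdjoint.star_eq, (hP _).1.isSelfAdjoint.star_eq] using
          congrArg star (hPQ e)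
      rw [← hQP, ← hPQ f, mul_assoc, ← mul_assoc (P _), horth _ _ h, zero_mul, mul_zero]
  have hequiv (e : E) : MvNEquiv (P (G.r e)) (Q e) :=
    -- Both projections have class `ξ[r(e)]`.
    (hP _).mvNEquiv_of_kZero_eq hR (hQ e) ((hξ _).trans (hqξ (G.s e) ⟨e, rfl⟩).symm)
  choose X h1 h2 h3 h4 using fun e => (hequiv e).exists_partial_isometry (hP _).1 (hQ e).1
  have hfam : IsLeavittFamily G P X :=
    { isStarProjection := fun a => (hP a).1
      orthogonal := fun {a b} h => horth a b h
      source_mul := fun e => by rw [← h4 e, ← mul_assoc, hPQ]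
      star_mul_self := h1
      mul_range := h3
      star_mul_ne := fun {e f} hef => by
        rw [← h4 e, ← h4 f, star_mul, (hQ e).1.isSelfAdjoint.star_eq, mul_assoc,
          ← mul_assoc (Q e), hQorth e f hef, zero_mul, mul_zero]
      vertex_eq_sum := fun {a} ha => by
        have := ha.finite.fintype
        rw [← hqsum a ha]
        simp only [h2, q_eq]
        exact (Finset.sum_subtype _ (by simp) _).symm }
  refine ⟨Leavitt.lift ℓ hfam, ⟨fun e => ?_, fun a _ => hP a⟩,
    DirGraph.bowenFranks_hom_ext fun a => ?_, fun a => rfl⟩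
  · rw [map_mul, map_star, lift_edge, h2]
    exact hQ e
  · rw [AddMonoidHom.comp_apply, can_bfClass, vertexClass, KZero.map_ofProj, ← hξ]
    rfl

end Construction

end

theorem mainTheorem10 {ℓ : Type*} [CommRing ℓ] [StarRing ℓ]
    {R : Type*} [Ring R] [StarRing R] [Algebra ℓ R] [StarModule ℓ R]
    (hR : IsStrictlyProperlyInfinite R)
    {V E : Type*} [Countable V] [Countable E] (G : DirGraph V E)
    (ξ : G.BowenFranks →+ KZero R) :
    (∃ φ : Leavitt ℓ G →⋆ₙₐ[ℓ] R,
      IsVeryFullHom φ ∧ (KZero.map φ).comp (Leavitt.can ℓ G) = ξ) ∧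
    (∀ [Fintype V] [Nonempty V] (p : R) (hp : IsVeryFullProjection p),
      ξ G.bfOne = KZero.ofProj p hp.1 →
      ∃ φ : Leavitt ℓ G →⋆ₙₐ[ℓ] R,
        IsVeryFullHom φ ∧ (KZero.map φ).comp (Leavitt.can ℓ G) = ξ ∧
          φ (Leavitt.unit ℓ G) = p) := by
  refine ⟨?_, fun {_ _} p hp h => ?_⟩
  · obtain ⟨P, hP, horth, -, hξ⟩ :=
      -- Countability of `V` lets all the vertex projections fit orthogonally below `1`.
      IsVeryFullProjection.one.exists_orthogonal hR fun a => ξ (G.bfClass a)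
    obtain ⟨φ, hφ, hφξ, -⟩ := Leavitt.exists_veryFullHom (ℓ := ℓ) hR ξ hP horth hξ
    exact ⟨φ, hφ, hφξ⟩
  · obtain ⟨P, hP, horth, -, hξ, hsum⟩ :=
      hp.exists_orthogonal_sum hR (fun a => ξ (G.bfClass a)) (by rw [← h, DirGraph.bfOne, map_sum])
    obtain ⟨φ, hφ, hφξ, hφv⟩ := Leavitt.exists_veryFullHom (ℓ := ℓ) hR ξ hP horth hξ
    refine ⟨φ, hφ, hφξ, ?_⟩
    rw [Leavitt.unit, map_sum]
    simp only [hφv, hsum]
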